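/- Let $D\ge 0$ be an even integer, let $F=\mathbb Z/2$, and let $V_D$ be the $F$-vector space with basis $e_1,\dots,e_D$ and bilinear form given by $(e_i,e_j)=1$ if $i-j=\pm1$ and $(e_i,e_j)=0$ otherwise. For $J\subset\{1,\dots,D\}$ put $e_J=\sum_{j\in J}e_j$. Let $V_D^0$ (resp. $V_D^1$) be the span of the $e_i$ with $i$ even (resp. odd), so that $V_D=V_D^0\oplus V_D^1$. Let $\mathcal I^1_D$ be the set of integer intervals $I=[a,b]$ with $1\le a\le b\le D$ and $a\equiv b \pmod 2$; put $\kappa(I)=0$ if $a,b$ are even and $\kappa(I)=1$ if $a,b$ are odd. For $I=[a,b]$ and $I'=[a',b']$ write $I\prec I'$ if $a'<a\le b<b'$, and $I\spadesuit I'$ if $a'-b\ge2$ or $a-b'\ge2$. Let $S_D$ be the set of all subsets $B\subset\mathcal I^1_D$ such that ($P_0$) for all $I,I'\in B$ one has $I=I'$ or $I\spadesuit I'$ or $I\prec I'$ or $I'\prec I$; ($P_1$) if $I=[a,b]\in B$ and $x\in I$, $x\equiv a+1\pmod 2$, then there is $I'\in B$ with $x\in I'$ and $I'\prec I$. Let $S_D^{D/2}=\{B\in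 S_D : |B|=D/2\}$, and let ${}^1S_D$ be the set of $B\in S_D$ such that $\kappa(I)=1$ for every $I\in B$ for which $I$ itself is the only $I'\in B$ with $I\subset I'$. For $B\in S_D$ let $\langle B\rangle$ be the span of $\{e_I : I\in B\}$ in $V_D$ and $\langle B\rangle_\delta=\langle B\rangle\cap V_D^\delta$ for $\delta\in\{0,1\}$. Let $\mathcal C(V_D^1)=\{\langle B\rangle_1 : B\in S_D\}$. For a subspace $\mathcal L\subset V_D^\delta$ let $\mathcal L^!=\{x\in V_D^{1-\delta} : (x,\mathcal L)=0\}$. Let $\mathcal A(V_D^1)$ be the set of pairs $(\mathcal L,\mathcal L')\in\mathcal C(V_D^1)\times\mathcal C(V_D^1)$ with $\mathcal L\subset\mathcal L'$ and $\mathcal L\oplus\mathcal L'^{\,!}=\langle B\rangle$ for some $B\in S_D$. Then: 1. $B\mapsto\langle B\rangle_1$ is a bijection $S_D^{D/2}\to\mathcal C(V_D^1)$. 2. $B\mapsto\langle B\rangle_1$ is a bijection ${}^1S_D\to\mathcal C(V_D^1)$. 3. For every $\mathcal L\in\mathcal C(V_D^1)$ the set $\{\mathcal L'\in\mathcal C(V_D^1)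 : (\mathcal L,\mathcal L')\in\mathcal A(V_D^1)\}$ contains a unique element $\mathcal L'$ with $|\mathcal L'|$ maximal; denote it by $\mathcal L^{max}$. 4. $B\mapsto(\langle B\rangle_1,\langle B\rangle_0^!)$ is a bijection from ${}^1S_D$ onto $\mathcal A^*(V_D^1)=\{(\mathcal L,\mathcal L^{max}) : \mathcal L\in\mathcal C(V_D^1)\}$. -/

import Mathlib

namespace AlmostSpecial

/-- The set of intervals `[a,b]` with `1 ≤ a ≤ b ≤ D` and `a = b` mod `2`; the interval `[a,b]` is
encoded by the pair `(a,b)` of its end points. -/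
def intervals (D : ℕ) : Finset (ℕ × ℕ) :=
  (Finset.Icc 1 D ×ˢ Finset.Icc 1 D).filter fun I => I.1 ≤ I.2 ∧ I.1 ≡ I.2 [MOD 2]

/-- The set of integers that belong to the interval encoded by `I`. -/
def pts (I : ℕ × ℕ) : Finset ℕ := Finset.Icc I.1 I.2

/-- `I ≺ I'`: for `I = [a,b]`, `I' = [a',b']`, this says `a' < a ≤ b < b'`. -/
def Prec (I I' : ℕ × ℕ) : Prop := I'.1 < I.1 ∧ I.1 ≤ I.2 ∧ I.2 < I'.2

/-- `I ♠ I'`: for `I = [a,b]`, `I' = [a',b']`, this says `a' - b ≥ 2` or `a - b' ≥ 2`. -/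
def Apart (I I' : ℕ × ℕ) : Prop := I.2 + 2 ≤ I'.1 ∨ I'.2 + 2 ≤ I.1

/-- `κ(I) ∈ {0,1}`: the common parity of the end points of `I`. -/
def kappa (I : ℕ × ℕ) : ℕ := I.1 % 2

/-- `I^{ev}`: the points of `I = [a,b]` whose parity is that of `a + 1`. -/
def evPts (I : ℕ × ℕ) : Finset ℕ := (pts I).filter fun x => x ≡ I.1 + 1 [MOD 2]

/-- Condition `(P₀)`. -/
def P0 (B : Finset (ℕ × ℕ)) : Prop :=
  ∀ I ∈ B, ∀ I' ∈ B, I = I' ∨ Apart I I' ∨ Prec I I' ∨ Prec I' I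

/-- Condition `(P₁)`. -/
def P1 (B : Finset (ℕ × ℕ)) : Prop :=
  ∀ I ∈ B, ∀ x ∈ evPts I, ∃ I' ∈ B, x ∈ pts I' ∧ Prec I' I

/-- The set `S_D`. -/
def S (D : ℕ) : Set (Finset (ℕ × ℕ)) := {B | B ⊆ intervals D ∧ P0 B ∧ P1 B}

/-- `m_{I,B}`: the number of `I' ∈ B` such that `I ⊆ I'`. -/
def mult (I : ℕ × ℕ) (B : Finset (ℕ × ℕ)) : ℕ := (B.filter fun I' => pts I ⊆ pts I').card

/-- The set `S_D^{D/2}` of all `B ∈ S_D` with `|B| = D/2`. -/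
def SHalf (D : ℕ) : Set (Finset (ℕ × ℕ)) := {B | B ∈ S D ∧ B.card = D / 2}

/-- The set `¹S_D` of all `B ∈ S_D` such that `κ(I) = 1` for any `I ∈ B` with `m_{I,B} = 1`. -/
def SOne (D : ℕ) : Set (Finset (ℕ × ℕ)) := {B | B ∈ S D ∧ ∀ I ∈ B, mult I B = 1 → kappa I = 1}

/-- The vector space `V_D` over `𝔽₂`, with coordinates indexed by `1, …, D`. -/
abbrev V (D : ℕ) : Type := ↥(Finset.Icc 1 D) → ZMod 2

/-- The basis vector `e_i`. -/
def e {D : ℕ} (i : ↥(Finset.Icc 1 D)) : V D := Pi.single i 1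

/-- `e_J = ∑_{j ∈ J} e_j` for `J ⊆ [1,D]`. -/
def eSum (D : ℕ) (J : Finset ℕ) : V D :=
  ∑ j ∈ Finset.univ.filter (fun j : ↥(Finset.Icc 1 D) => (j : ℕ) ∈ J), e j

/-- The bilinear form on `V_D` with `(e_i, e_j) = 1` if `i - j = ±1` and `0` otherwise. -/
noncomputable def form (D : ℕ) : LinearMap.BilinForm (ZMod 2) (V D) :=
  Matrix.toBilin' (Matrix.of fun i j : ↥(Finset.Icc 1 D) =>
    if (i : ℕ) = j + 1 ∨ (j : ℕ) = i + 1 then (1 : ZMod 2) else 0)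

/-- `V_D^δ`, spanned by the `e_i` with `i = δ` mod `2`. -/
def part (D : ℕ) (δ : ZMod 2) : Submodule (ZMod 2) (V D) :=
  Submodule.span (ZMod 2) {v | ∃ i : ↥(Finset.Icc 1 D), ((i : ℕ) : ZMod 2) = δ ∧ v = e i}

/-- `⟨B⟩`, the subspace of `V_D` spanned by the `e_I` with `I ∈ B`. -/
def spanB (D : ℕ) (B : Finset (ℕ × ℕ)) : Submodule (ZMod 2) (V D) :=
  Submodule.span (ZMod 2) {v | ∃ I ∈ B, v = eSum D (pts I)}

/-- `⟨B⟩_δ = ⟨B⟩ ∩ V_D^δ`. -/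
def spanPart (D : ℕ) (δ : ZMod 2) (B : Finset (ℕ × ℕ)) : Submodule (ZMod 2) (V D) :=
  spanB D B ⊓ part D δ

/-- For a subspace `L` of `V_D^δ`, `L^! = {x ∈ V_D^{1-δ} | (x, L) = 0}` (the form is symmetric). -/
noncomputable def bang (D : ℕ) (δ : ZMod 2) (L : Submodule (ZMod 2) (V D)) :
    Submodule (ZMod 2) (V D) :=
  part D (1 - δ) ⊓ (form D).orthogonal L

/-- `𝒞(V_D^δ)`, the set of subspaces of the form `⟨B⟩_δ` with `B ∈ S_D`. -/
def C (D : ℕ) (δ : ZMod 2) : Set (Submodule (ZMod 2) (V D)) := {L | ∃ B ∈ S D, L = spanPart D δ B}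

/-- `𝒜(V_D^1)`, the set of `(L, L')` in `𝒞(V_D^1) × 𝒞(V_D^1)` with `L ⊆ L'` and
`L ⊕ L'^! = ⟨B⟩` for some `B ∈ S_D`. -/
def A (D : ℕ) : Set (Submodule (ZMod 2) (V D) × Submodule (ZMod 2) (V D)) :=
  {p | p.1 ∈ C D 1 ∧ p.2 ∈ C D 1 ∧ p.1 ≤ p.2 ∧
    ∃ B ∈ S D, Disjoint p.1 (bang D 1 p.2) ∧ p.1 ⊔ bang D 1 p.2 = spanB D B}

/-- `L' = L^{max}`: the subspace `L'` belongs to `{L' ∈ 𝒞(V_D^1) | (L, L') ∈ 𝒜(V_D^1)}` and has the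
largest cardinality among the elements of this set. -/
def IsMaxPartner (D : ℕ) (L L' : Submodule (ZMod 2) (V D)) : Prop :=
  (L, L') ∈ A D ∧ ∀ L'' : Submodule (ZMod 2) (V D), (L, L'') ∈ A D → Nat.card L'' ≤ Nat.card L'

/-- `𝒜^*(V_D^1)`, the set of pairs `(L, L^{max})` with `L ∈ 𝒞(V_D^1)`. -/
def AStar (D : ℕ) : Set (Submodule (ZMod 2) (V D) × Submodule (ZMod 2) (V D)) :=
  {p | p.1 ∈ C D 1 ∧ p.2 ∈ C D 1 ∧ IsMaxPartner D p.1 p.2}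

end AlmostSpecial

namespace AlmostSpecial

/-! The points owned by an interval of `B` all have the parity of its end points, by (P₁). Hence the
indicator vectors of the owned sets are homogeneous. They span `⟨B⟩`, which consists of the vectors
that vanish off the union of `B` and are constant on each owned set (`mem_spanB`). So `⟨B⟩ = ⟨B⟩_1 ⊕
⟨B⟩_0`, and `⟨B⟩_δ` determines the intervals of `B` of parity δ (`mem_of_spanPart_eq`).

Two operations change `B` without changing `⟨B⟩_δ`: discarding maximal intervals of the other
parity, and then inserting intervals of the other parity into the gaps between uncovered points of
parity δ. For δ = 1 the first lands in `¹S_D`; both together reach cardinality `D/2`, which is the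
largest possible. This gives both surjectivity claims.

At cardinality `D/2`, `⟨B⟩_1` and `⟨B⟩_0` are annihilators of each other (`Full.bang_zero`,
`Full.bang_one`), so `⟨B⟩_1` determines `B`. In `¹S_D` the odd intervals already cover the union of
`B`, so `⟨B⟩_0` is recovered as the vectors of `V_D^0` orthogonal to `⟨B⟩_1` and supported on that
union.

Finally, a pair `(L, L')` in `𝒜` comes from some `B₁` with `⟨B₁⟩_1 = L` and `⟨B₁⟩_0 = L'^!`.
Trimming `B₁` gives the unique `B` in `¹S_D` over `L`, so `⟨B⟩_0 ⊆ ⟨B₁⟩_0` and `L' ⊆ ⟨B⟩_0^!`. This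
bound is attained by `B` itself. -/

/-- The point `x` belongs to some interval of `B`. -/
def Cov (B : Finset (ℕ × ℕ)) (x : ℕ) : Prop := ∃ I ∈ B, I.1 ≤ x ∧ x ≤ I.2

/-- The point `x` belongs to `I` but to no smaller interval of `B`. -/
def Own (B : Finset (ℕ × ℕ)) (I : ℕ × ℕ) (x : ℕ) : Prop :=
  I.1 ≤ x ∧ x ≤ I.2 ∧ ∀ J ∈ B, Prec J I → ¬(J.1 ≤ x ∧ x ≤ J.2)

theorem mem_intervals {D : ℕ} {I : ℕ × ℕ} :
    I ∈ intervals D ↔ 1 ≤ I.1 ∧ I.1 ≤ I.2 ∧ I.2 ≤ D ∧ I.1 % 2 = I.2 % 2 := by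
  rw [intervals, Finset.mem_filter, Finset.mem_product, Finset.mem_Icc, Finset.mem_Icc, Nat.ModEq]
  omega

theorem mem_evPts {I : ℕ × ℕ} {x : ℕ} :
    x ∈ evPts I ↔ I.1 ≤ x ∧ x ≤ I.2 ∧ x % 2 ≠ I.1 % 2 := by
  rw [evPts, pts, Finset.mem_filter, Finset.mem_Icc, Nat.ModEq]
  omega

/-! ### Ownership of points in a nested family. -/

section Laminar

variable {D : ℕ} {B : Finset (ℕ × ℕ)}

theorem exists_prec_of_odd_offset (hB : B ∈ S D) {I : ℕ × ℕ} (hI : I ∈ B) {x : ℕ}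
    (h1 : I.1 ≤ x) (h2 : x ≤ I.2) (h3 : x % 2 ≠ I.1 % 2) :
    ∃ J ∈ B, J.1 ≤ x ∧ x ≤ J.2 ∧ Prec J I := by
  obtain ⟨J, hJ, hx, hJI⟩ := hB.2.2 I hI x (mem_evPts.2 ⟨h1, h2, h3⟩)
  rw [pts, Finset.mem_Icc] at hx
  exact ⟨J, hJ, hx.1, hx.2, hJI⟩

theorem Own.mod_two_eq (hB : B ∈ S D) {I : ℕ × ℕ} (hI : I ∈ B) {x : ℕ} (h : Own B I x) :
    x % 2 = I.1 % 2 := by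
  by_contra h3
  obtain ⟨J, hJ, h1, h2, hJI⟩ := exists_prec_of_odd_offset hB hI h.1 h.2.1 h3
  exact h.2.2 J hJ hJI ⟨h1, h2⟩

theorem own_left (hB : B ∈ S D) {I : ℕ × ℕ} (hI : I ∈ B) : Own B I I.1 := by
  have := mem_intervals.1 (hB.1 hI)
  refine ⟨le_rfl, this.2.1, fun J _ h => ?_⟩
  simp only [Prec] at h
  omega

theorem own_right (hB : B ∈ S D) {I : ℕ × ℕ} (hI : I ∈ B) : Own B I I.2 := by
  have := mem_intervals.1 (hB.1 hI)
  refine ⟨this.2.1, le_rfl, fun J _ h => ?_⟩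
  simp only [Prec] at h
  omega

theorem exists_own {x : ℕ} (h : Cov B x) : ∃ I ∈ B, Own B I x := by
  classical
  obtain ⟨I₀, hI₀, h₀⟩ := h
  obtain ⟨I, hI, hmin⟩ := Finset.exists_min_image (B.filter fun I => I.1 ≤ x ∧ x ≤ I.2)
    (fun I => I.2 - I.1) ⟨I₀, by simp [hI₀, h₀]⟩
  rw [Finset.mem_filter] at hI
  refine ⟨I, hI.1, hI.2.1, hI.2.2, fun J hJ hJI hx => ?_⟩
  have := hmin J (by simp [hJ, hx])
  simp only [Prec] at hJI
  omega

theorem eq_or_prec_of_own (hB : B ∈ S D) {I J : ℕ × ℕ} (hI : I ∈ B) (hJ : J ∈ B) {x : ℕ}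
    (h : Own B I x) (h1 : J.1 ≤ x) (h2 : x ≤ J.2) : I = J ∨ Prec I J := by
  rcases hB.2.1 I hI J hJ with h' | h' | h' | h'
  · exact Or.inl h'
  · have := h.1
    have := h.2.1
    simp only [Apart] at h'
    omega
  · exact Or.inr h'
  · exact absurd ⟨h1, h2⟩ (h.2.2 J hJ h')

theorem own_unique (hB : B ∈ S D) {I J : ℕ × ℕ} (hI : I ∈ B) (hJ : J ∈ B) {x : ℕ}
    (h : Own B I x) (h' : Own B J x) : I = J := by
  rcases eq_or_prec_of_own hB hI hJ h h'.1 h'.2.1 with h1 | h1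
  · exact h1
  · exact absurd ⟨h.1, h.2.1⟩ (h'.2.2 I hI h1)

theorem prec_of_left_neighbour (hB : B ∈ S D) {I J : ℕ × ℕ} (hI : I ∈ B) (hJ : J ∈ B)
    (h1 : J.1 ≤ I.1 - 1) (h2 : I.1 - 1 ≤ J.2) : Prec I J := by
  have hi := mem_intervals.1 (hB.1 hI)
  rcases hB.2.1 I hI J hJ with h | h | h | h
  · subst h
    omega
  · simp only [Apart] at h
    omega
  · exact h
  · simp only [Prec] at h
    omega

theorem prec_of_right_neighbour (hB : B ∈ S D) {I J : ℕ × ℕ} (hI : I ∈ B) (hJ : J ∈ B)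
    (h1 : J.1 ≤ I.2 + 1) (h2 : I.2 + 1 ≤ J.2) : Prec I J := by
  have hi := mem_intervals.1 (hB.1 hI)
  rcases hB.2.1 I hI J hJ with h | h | h | h
  · subst h
    omega
  · simp only [Apart] at h
    omega
  · exact h
  · simp only [Prec] at h
    omega

/-- The owner of the point just left of `I` must enclose `I`, and it has the parity of that point.
-/
theorem exists_prec_mod_two_ne (hB : B ∈ S D) {I J : ℕ × ℕ} (hI : I ∈ B) (hJ : J ∈ B)
    (h : Prec I J) : ∃ P ∈ B, Prec I P ∧ P.1 % 2 ≠ I.1 % 2 := by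
  have hi := mem_intervals.1 (hB.1 hI)
  obtain ⟨P, hP, hx⟩ := exists_own (B := B) (x := I.1 - 1) ⟨J, hJ, by
    simp only [Prec] at h
    omega⟩
  refine ⟨P, hP, prec_of_left_neighbour hB hI hP hx.1 hx.2.1, ?_⟩
  have := hx.mod_two_eq hB hP
  omega

/-- The point `p + 1` has the wrong parity for `I`, so (P₁) supplies `K`, which cannot reach back to
`p`. A member inside `I` covering `K.2 + 1` would enclose `K` and hence contain `p`. Iterating walks
through the points owned by `I` up to its right end. -/
theorem Own.exists_child (hB : B ∈ S D) {I : ℕ × ℕ} (hI : I ∈ B) {p : ℕ} (h : Own B I p)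
    (hp : p < I.2) : ∃ K ∈ B, Prec K I ∧ K.1 = p + 1 ∧ Own B I (K.2 + 1) := by
  have hm := h.mod_two_eq hB hI
  have h1 := h.1
  obtain ⟨K, hK, hK1, hK2, hKI⟩ := exists_prec_of_odd_offset hB hI (x := p + 1)
    (by omega) (by omega) (by omega)
  have hpK := h.2.2 K hK hKI
  have hKp : K.1 = p + 1 := by omega
  refine ⟨K, hK, hKI, hKp, ?_, ?_, fun J hJ hJI hx => h.2.2 J hJ hJI ?_⟩
  · omega
  · exact hKI.2.2
  · have hKJ := prec_of_right_neighbour hB hK hJ hx.1 hx.2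
    simp only [Prec] at hKJ
    omega

theorem mult_eq_one_iff (hB : B ∈ S D) {I : ℕ × ℕ} (hI : I ∈ B) :
    mult I B = 1 ↔ ∀ J ∈ B, ¬Prec I J := by
  have hi := mem_intervals.1 (hB.1 hI)
  have hsub : ∀ J : ℕ × ℕ, pts I ⊆ pts J ↔ J.1 ≤ I.1 ∧ I.2 ≤ J.2 := fun J =>
    Finset.Icc_subset_Icc_iff hi.2.1
  have hmem : I ∈ B.filter fun J => pts I ⊆ pts J := by simp [hI]
  rw [mult, Finset.card_eq_one]
  constructor
  · rintro ⟨a, ha⟩ J hJ hIJ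
    have hJm : J ∈ B.filter fun J => pts I ⊆ pts J := by
      rw [Finset.mem_filter, hsub]
      exact ⟨hJ, hIJ.1.le, hIJ.2.2.le⟩
    rw [ha, Finset.mem_singleton] at hmem hJm
    subst hmem
    subst hJm
    exact absurd hIJ.1 (lt_irrefl _)
  · intro h
    refine ⟨I, Finset.eq_singleton_iff_unique_mem.2 ⟨hmem, fun J hJ => ?_⟩⟩
    rw [Finset.mem_filter, hsub] at hJ
    rcases hB.2.1 I hI J hJ.1 with h' | h' | h' | h'
    · exact h'.symm
    · simp only [Apart] at h'
      omega
    · exact absurd h' (h J hJ.1)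
    · simp only [Prec] at h'
      omega

end Laminar

/-! ### Removing maximal intervals of one parity. -/

section Trim

variable {D : ℕ} {B : Finset (ℕ × ℕ)}

open Classical in
/-- Remove from `B` the maximal intervals whose end points do not have parity `d`. -/
noncomputable def trim (d : ℕ) (B : Finset (ℕ × ℕ)) : Finset (ℕ × ℕ) :=
  B.filter fun I => I.1 % 2 = d ∨ ∃ J ∈ B, Prec I J

theorem mem_trim {d : ℕ} {I : ℕ × ℕ} :
    I ∈ trim d B ↔ I ∈ B ∧ (I.1 % 2 = d ∨ ∃ J ∈ B, Prec I J) := by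
  simp [trim]

theorem trim_subset (d : ℕ) (B : Finset (ℕ × ℕ)) : trim d B ⊆ B := fun _ h => (mem_trim.1 h).1

theorem trim_mem_S (hB : B ∈ S D) (d : ℕ) : trim d B ∈ S D := by
  refine ⟨fun I hI => hB.1 (trim_subset d B hI),
    fun I hI J hJ => hB.2.1 I (trim_subset d B hI) J (trim_subset d B hJ), fun I hI x hx => ?_⟩
  obtain ⟨J, hJ, hxJ, hJI⟩ := hB.2.2 I (trim_subset d B hI) x hx
  exact ⟨J, mem_trim.2 ⟨hJ, Or.inr ⟨I, trim_subset d B hI, hJI⟩⟩, hxJ, hJI⟩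

/-- This is the hypothesis under which gaps can be filled: every interval lies in one of parity `d`.
-/
theorem exists_parent_mem_trim (hB : B ∈ S D) {d : ℕ} (hd : d < 2) {I : ℕ × ℕ}
    (hI : I ∈ trim d B) : I.1 % 2 = d ∨ ∃ P ∈ trim d B, Prec I P ∧ P.1 % 2 = d := by
  obtain ⟨hIB, h | ⟨J, hJ, hIJ⟩⟩ := mem_trim.1 hI
  · exact Or.inl h
  · by_cases h : I.1 % 2 = d
    · exact Or.inl h
    · obtain ⟨P, hP, hIP, hpar⟩ := exists_prec_mod_two_ne hB hIB hJ hIJ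
      have : P.1 % 2 = d := by omega
      exact Or.inr ⟨P, mem_trim.2 ⟨hP, Or.inl this⟩, hIP, this⟩

theorem trim_mem_SOne (hB : B ∈ S D) : trim 1 B ∈ SOne D := by
  refine ⟨trim_mem_S hB 1, fun I hI hm => ?_⟩
  rw [mult_eq_one_iff (trim_mem_S hB 1) hI] at hm
  rcases exists_parent_mem_trim hB one_lt_two hI with h | ⟨P, hP, hIP, -⟩
  · exact h
  · exact absurd hIP (hm P hP)

end Trim

/-! ### Inserting intervals into the gaps. -/

section Fill

variable {D : ℕ} {B : Finset (ℕ × ℕ)}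

open Classical in
/-- The intervals strictly between two consecutive points of parity `d` in `[0, D + 1]` that are
not covered by `B`. -/
noncomputable def gaps (D d : ℕ) (B : Finset (ℕ × ℕ)) : Finset (ℕ × ℕ) :=
  (intervals D).filter fun K => (K.1 - 1) % 2 = d ∧ ¬Cov B (K.1 - 1) ∧ ¬Cov B (K.2 + 1) ∧
    ∀ r, K.1 ≤ r → r ≤ K.2 → r % 2 = d → Cov B r

theorem mem_gaps {d : ℕ} {K : ℕ × ℕ} :
    K ∈ gaps D d B ↔ K ∈ intervals D ∧ (K.1 - 1) % 2 = d ∧ ¬Cov B (K.1 - 1) ∧ ¬Cov B (K.2 + 1) ∧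
      ∀ r, K.1 ≤ r → r ≤ K.2 → r % 2 = d → Cov B r := by
  simp [gaps]

open Classical in
/-- Adjoin to `B` the intervals between consecutive uncovered points of parity `d`. -/
noncomputable def fill (D d : ℕ) (B : Finset (ℕ × ℕ)) : Finset (ℕ × ℕ) := B ∪ gaps D d B

theorem mem_fill {d : ℕ} {K : ℕ × ℕ} : K ∈ fill D d B ↔ K ∈ B ∨ K ∈ gaps D d B := by
  simp [fill]

/-- Enclose `I` in some `T` of parity `d`. Since `T` misses both points bordering `K`, it lies well
outside `K` or within it; in the latter case parity keeps it off the end points of `K`. -/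
theorem apart_or_prec_of_mem_gaps (hB : B ∈ S D) {d : ℕ}
    (hpar : ∀ I ∈ B, I.1 % 2 = d ∨ ∃ P ∈ B, Prec I P ∧ P.1 % 2 = d) {I K : ℕ × ℕ} (hI : I ∈ B)
    (hK : K ∈ gaps D d B) : Apart I K ∨ Prec I K := by
  obtain ⟨hKi, hKd, hl, hr, -⟩ := mem_gaps.1 hK
  rw [mem_intervals] at hKi
  have hi := mem_intervals.1 (hB.1 hI)
  obtain ⟨T, hT, hTd, hT1, hT2⟩ : ∃ T ∈ B, T.1 % 2 = d ∧ T.1 ≤ I.1 ∧ I.2 ≤ T.2 := by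
    rcases hpar I hI with h | ⟨P, hP, hIP, hPd⟩
    · exact ⟨I, hI, h, le_rfl, le_rfl⟩
    · exact ⟨P, hP, hPd, hIP.1.le, hIP.2.2.le⟩
  have ht := mem_intervals.1 (hB.1 hT)
  have h1 : ¬(T.1 ≤ K.1 - 1 ∧ K.1 - 1 ≤ T.2) := fun h => hl ⟨T, hT, h⟩
  have h2 : ¬(T.1 ≤ K.2 + 1 ∧ K.2 + 1 ≤ T.2) := fun h => hr ⟨T, hT, h⟩
  simp only [Apart, Prec]
  omega

theorem eq_or_apart_of_mem_gaps {d : ℕ} {K K' : ℕ × ℕ} (hK : K ∈ gaps D d B)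
    (hK' : K' ∈ gaps D d B) : K = K' ∨ Apart K K' := by
  obtain ⟨hi, hd, hl, hr, hc⟩ := mem_gaps.1 hK
  obtain ⟨hi', hd', hl', hr', hc'⟩ := mem_gaps.1 hK'
  rw [mem_intervals] at hi hi'
  have h1 : ¬(K.1 ≤ K'.1 - 1 ∧ K'.1 - 1 ≤ K.2) := fun h => hl' (hc _ h.1 h.2 hd')
  have h2 : ¬(K'.1 ≤ K.1 - 1 ∧ K.1 - 1 ≤ K'.2) := fun h => hl (hc' _ h.1 h.2 hd)
  have h3 : ¬(K.1 ≤ K'.2 + 1 ∧ K'.2 + 1 ≤ K.2) := fun h => hr' (hc _ h.1 h.2 (by omega))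
  have h4 : ¬(K'.1 ≤ K.2 + 1 ∧ K.2 + 1 ≤ K'.2) := fun h => hr (hc' _ h.1 h.2 (by omega))
  rw [Prod.ext_iff]
  simp only [Apart]
  omega

theorem fill_mem_S (hB : B ∈ S D) {d : ℕ}
    (hpar : ∀ I ∈ B, I.1 % 2 = d ∨ ∃ P ∈ B, Prec I P ∧ P.1 % 2 = d) : fill D d B ∈ S D := by
  refine ⟨fun K hK => ?_, fun I hI J hJ => ?_, fun I hI x hx => ?_⟩
  · rcases mem_fill.1 hK with h | h
    · exact hB.1 h
    · exact (mem_gaps.1 h).1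
  · rcases mem_fill.1 hI with hI | hI <;> rcases mem_fill.1 hJ with hJ | hJ
    · exact hB.2.1 I hI J hJ
    · rcases apart_or_prec_of_mem_gaps hB hpar hI hJ with h | h
      · exact Or.inr (Or.inl h)
      · exact Or.inr (Or.inr (Or.inl h))
    · rcases apart_or_prec_of_mem_gaps hB hpar hJ hI with h | h
      · exact Or.inr (Or.inl (Or.symm h))
      · exact Or.inr (Or.inr (Or.inr h))
    · rcases eq_or_apart_of_mem_gaps hI hJ with h | h
      · exact Or.inl h
      · exact Or.inr (Or.inl h)
  · rcases mem_fill.1 hI with hI | hI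
    · obtain ⟨J, hJ, h⟩ := hB.2.2 I hI x hx
      exact ⟨J, mem_fill.2 (Or.inl hJ), h⟩
    · obtain ⟨hi, hd, -, -, hc⟩ := mem_gaps.1 hI
      rw [mem_intervals] at hi
      rw [mem_evPts] at hx
      obtain ⟨J, hJ, h1, h2⟩ := hc x hx.1 hx.2.1 (by omega)
      refine ⟨J, mem_fill.2 (Or.inl hJ), Finset.mem_Icc.2 ⟨h1, h2⟩, ?_⟩
      rcases apart_or_prec_of_mem_gaps hB hpar hJ hI with h | h
      · simp only [Apart] at h
        omega
      · exact h

end Fill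

/-! ### Families of maximal cardinality. -/

section Full

variable {D : ℕ} {B : Finset (ℕ × ℕ)}

/-- For each odd `p = 2k+1` with `1 ≤ p ≤ D - 1`, an interval of `B` with odd end points ends at
`p`, or an interval of `B` with even end points starts at `p + 1`. -/
def Full (D : ℕ) (B : Finset (ℕ × ℕ)) : Prop :=
  ∀ p, p % 2 = 1 → p < D → ∃ I ∈ B, I.2 = p ∨ I.1 = p + 1

theorem card_eq_iff_full (hD : Even D) (hB : B ∈ S D) : B.card = D / 2 ↔ Full D B := by
  have hD2 : D % 2 = 0 := Nat.even_iff.1 hD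
  -- Each interval is charged to the odd number `2k + 1` equal to its right end (odd case) or to its
  -- left end minus one (even case). No two members share a charge, so `|B| ≤ D/2`, with equality
  -- exactly when every `k` occurs.
  set f : ℕ × ℕ → ℕ := fun I => if I.1 % 2 = 1 then I.2 / 2 else I.1 / 2 - 1 with hf
  have hinj : Set.InjOn f B := by
    intro I hI J hJ hIJ
    have hi := mem_intervals.1 (hB.1 hI)
    have hj := mem_intervals.1 (hB.1 hJ)
    rcases hB.2.1 I hI J hJ with h | h
    · exact h
    · exfalso
      simp only [Apart, Prec] at h
      simp only [hf] at hIJ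
      split_ifs at hIJ <;> omega
  have hsub : B.image f ⊆ Finset.range (D / 2) := by
    intro k hk
    obtain ⟨I, hI, rfl⟩ := Finset.mem_image.1 hk
    have hi := mem_intervals.1 (hB.1 hI)
    simp only [hf, Finset.mem_range]
    split_ifs <;> omega
  have hcard : (B.image f).card = B.card := Finset.card_image_of_injOn hinj
  constructor
  · intro h p hp hpD
    have heq : B.image f = Finset.range (D / 2) :=
      Finset.eq_of_subset_of_card_le hsub (by rw [hcard, h, Finset.card_range])
    have hk : p / 2 ∈ B.image f := by
      rw [heq, Finset.mem_range]
      omega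
    obtain ⟨I, hI, hIk⟩ := Finset.mem_image.1 hk
    have hi := mem_intervals.1 (hB.1 hI)
    refine ⟨I, hI, ?_⟩
    simp only [hf] at hIk
    split_ifs at hIk <;> omega
  · intro h
    have heq : B.image f = Finset.range (D / 2) := by
      refine Finset.Subset.antisymm hsub fun k hk => ?_
      rw [Finset.mem_range] at hk
      obtain ⟨I, hI, hIk⟩ := h (2 * k + 1) (by omega) (by omega)
      have hi := mem_intervals.1 (hB.1 hI)
      refine Finset.mem_image.2 ⟨I, hI, ?_⟩
      simp only [hf]
      split_ifs <;> omega
    rw [← hcard, heq, Finset.card_range]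

theorem exists_endpoint_of_cov (hB : B ∈ S D) {p : ℕ} (h : Cov B p) :
    ∃ I ∈ B, I.2 = p ∨ I.1 = p + 1 := by
  obtain ⟨I, hI, hp⟩ := exists_own h
  rcases hp.2.1.eq_or_lt with h1 | h1
  · exact ⟨I, hI, Or.inl h1.symm⟩
  · obtain ⟨K, hK, -, hK1, -⟩ := hp.exists_child hB hI h1
    exact ⟨K, hK, Or.inr hK1⟩

theorem not_cov_zero (hB : B ∈ S D) : ¬Cov B 0 := by
  rintro ⟨I, hI, h, -⟩
  have := mem_intervals.1 (hB.1 hI)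
  omega

theorem not_cov_succ (hB : B ∈ S D) : ¬Cov B (D + 1) := by
  rintro ⟨I, hI, -, h⟩
  have := mem_intervals.1 (hB.1 hI)
  omega

theorem full_fill_one (hD : Even D) (hB : B ∈ S D) : Full D (fill D 1 B) := by
  classical
  have hD2 : D % 2 = 0 := Nat.even_iff.1 hD
  intro p hp hpD
  by_cases hc : Cov B p
  · obtain ⟨I, hI, h⟩ := exists_endpoint_of_cov hB hc
    exact ⟨I, mem_fill.2 (Or.inl hI), h⟩
  · have hex : ∃ q, p < q ∧ q % 2 = 1 ∧ ¬Cov B q := ⟨D + 1, by omega, by omega, not_cov_succ hB⟩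
    obtain ⟨h1, h2, h3⟩ := Nat.find_spec hex
    have h4 : Nat.find hex ≤ D + 1 := Nat.find_min' hex ⟨by omega, by omega, not_cov_succ hB⟩
    have h5 : ∀ r < Nat.find hex, ¬(p < r ∧ r % 2 = 1 ∧ ¬Cov B r) := fun r hr =>
      Nat.find_min hex hr
    generalize Nat.find hex = q at h1 h2 h3 h4 h5
    refine ⟨(p + 1, q - 1), mem_fill.2 (Or.inr (mem_gaps.2 ⟨mem_intervals.2 ?_, ?_, ?_, ?_, ?_⟩)),
      Or.inr rfl⟩
    · dsimp only
      omega
    · simpa using hp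
    · simpa using hc
    · rwa [Nat.sub_add_cancel (by omega)]
    · intro r hr1 hr2 hr
      dsimp only at hr1 hr2
      by_contra hcr
      exact h5 r (by omega) ⟨by omega, hr, hcr⟩

theorem full_fill_zero (hB : B ∈ S D) : Full D (fill D 0 B) := by
  classical
  intro p hp hpD
  by_cases hc : Cov B (p + 1)
  · by_cases hc' : Cov B p
    · obtain ⟨I, hI, h⟩ := exists_endpoint_of_cov hB hc'
      exact ⟨I, mem_fill.2 (Or.inl hI), h⟩
    · obtain ⟨I, hI, h1, h2⟩ := hc
      refine ⟨I, mem_fill.2 (Or.inl hI), Or.inr ?_⟩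
      by_contra h
      exact hc' ⟨I, hI, by omega, by omega⟩
  -- The gap ending at `p` starts after the last uncovered even point, which exists because `0` is
  -- uncovered.
  · set P : ℕ → Prop := fun q => q % 2 = 0 ∧ ¬Cov B q with hP
    have hP0 : P 0 := ⟨rfl, not_cov_zero hB⟩
    have h1 : P (Nat.findGreatest P p) := Nat.findGreatest_spec (Nat.zero_le p) hP0
    have h2 : Nat.findGreatest P p ≤ p := Nat.findGreatest_le p
    have h3 : ∀ r, Nat.findGreatest P p < r → r ≤ p → ¬P r := fun r hr hrp =>
      Nat.findGreatest_is_greatest hr hrp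
    generalize Nat.findGreatest P p = q at h1 h2 h3
    have h0 := h1.1
    refine ⟨(q + 1, p), mem_fill.2 (Or.inr (mem_gaps.2 ⟨mem_intervals.2 ?_, ?_, ?_, hc, ?_⟩)),
      Or.inl rfl⟩
    · dsimp only
      omega
    · simpa using h0
    · simpa using h1.2
    · intro r hr1 hr2 hr
      dsimp only at hr1 hr2
      by_contra hcr
      exact h3 r (by omega) hr2 ⟨hr, hcr⟩

end Full

/-! ### Coordinates, the grading and the form. -/

section Coordinates

variable {D : ℕ}

/-- The coefficient of `e_x`, which is `0` when `x` is not in `[1, D]`. -/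
def coord (D x : ℕ) : V D →ₗ[ZMod 2] ZMod 2 :=
  if h : x ∈ Finset.Icc 1 D then LinearMap.proj ⟨x, h⟩ else 0

theorem coord_of_mem {x : ℕ} (h : x ∈ Finset.Icc 1 D) (v : V D) : coord D x v = v ⟨x, h⟩ := by
  rw [coord, dif_pos h]
  rfl

theorem coord_of_not_mem {x : ℕ} (h : x ∉ Finset.Icc 1 D) (v : V D) : coord D x v = 0 := by
  rw [coord, dif_neg h]
  rfl

theorem coord_coe (i : ↥(Finset.Icc 1 D)) (v : V D) : coord D i v = v i := coord_of_mem i.2 v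

theorem ext_coord {v w : V D} (h : ∀ x, coord D x v = coord D x w) : v = w := by
  funext i
  rw [← coord_coe i v, ← coord_coe i w, h]

theorem coord_e (i : ↥(Finset.Icc 1 D)) (x : ℕ) : coord D x (e i) = if x = i then 1 else 0 := by
  by_cases h : x ∈ Finset.Icc 1 D
  · rw [coord_of_mem h, e, Pi.single_apply]
    simp only [Subtype.ext_iff]
  · rw [coord_of_not_mem h, if_neg]
    rintro rfl
    exact h i.2

theorem coord_eSum (J : Finset ℕ) (x : ℕ) :
    coord D x (eSum D J) = if x ∈ J ∧ x ∈ Finset.Icc 1 D then 1 else 0 := by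
  rw [eSum, map_sum]
  simp only [coord_e]
  by_cases h : x ∈ Finset.Icc 1 D
  · have : ∀ i : ↥(Finset.Icc 1 D), x = i ↔ (⟨x, h⟩ : ↥(Finset.Icc 1 D)) = i := fun i => by
      rw [Subtype.ext_iff]
    simp only [this, Finset.sum_ite_eq, Finset.mem_filter, Finset.mem_univ, true_and, h, and_true]
  · rw [if_neg fun h' => h h'.2]
    refine Finset.sum_eq_zero fun i _ => if_neg ?_
    rintro rfl
    exact h i.2

theorem coord_eSum_pts {B : Finset (ℕ × ℕ)} (hB : B ∈ S D) {I : ℕ × ℕ} (hI : I ∈ B) (x : ℕ) :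
    coord D x (eSum D (pts I)) = if I.1 ≤ x ∧ x ≤ I.2 then 1 else 0 := by
  have hi := mem_intervals.1 (hB.1 hI)
  rw [coord_eSum, pts]
  simp only [Finset.mem_Icc]
  refine if_congr ?_ rfl rfl
  omega

theorem mem_part {d : ℕ} {v : V D} :
    v ∈ part D (d : ZMod 2) ↔ ∀ x, x % 2 ≠ d % 2 → coord D x v = 0 := by
  constructor
  · intro h
    induction h using Submodule.span_induction with
    | mem v hv =>
      obtain ⟨i, hi, rfl⟩ := hv
      intro x hx
      rw [coord_e, if_neg]
      rintro rfl
      exact hx ((ZMod.natCast_eq_natCast_iff _ _ _).1 hi)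
    | zero => simp
    | add v w _ _ hv hw => intro x hx; rw [map_add, hv x hx, hw x hx, add_zero]
    | smul c v _ hv => intro x hx; rw [map_smul, hv x hx, smul_zero]
  · intro h
    have hv : v = ∑ i, v i • e i := by
      refine ext_coord fun x => ?_
      rw [map_sum]
      simp only [map_smul, coord_e]
      by_cases hx : x ∈ Finset.Icc 1 D
      · have : ∀ i : ↥(Finset.Icc 1 D), x = i ↔ (⟨x, hx⟩ : ↥(Finset.Icc 1 D)) = i := fun i => by
          rw [Subtype.ext_iff]
        simp [this, coord_of_mem hx]
      · rw [coord_of_not_mem hx]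
        refine (Finset.sum_eq_zero fun i _ => ?_).symm
        rw [if_neg, smul_zero]
        rintro rfl
        exact hx i.2
    rw [hv]
    refine Submodule.sum_mem _ fun i _ => ?_
    by_cases hi : (i : ℕ) % 2 = d % 2
    · exact Submodule.smul_mem _ _
        (Submodule.subset_span ⟨i, (ZMod.natCast_eq_natCast_iff _ _ _).2 hi, rfl⟩)
    · rw [← coord_coe i v, h i hi, zero_smul]
      exact Submodule.zero_mem _

theorem form_e (i : ↥(Finset.Icc 1 D)) (v : V D) :
    form D (e i) v = coord D (i - 1) v + coord D (i + 1) v := by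
  have hi := Finset.mem_Icc.1 i.2
  have h : form D (e i) = coord D (i - 1) + coord D (i + 1) := by
    refine LinearMap.pi_ext' fun j => LinearMap.ext_ring ?_
    have hj := Finset.mem_Icc.1 j.2
    change form D (e i) (e j) = coord D (i - 1) (e j) + coord D (i + 1) (e j)
    rw [coord_e, coord_e]
    have : form D (e i) (e j) = if (i : ℕ) = j + 1 ∨ (j : ℕ) = i + 1 then 1 else 0 := by
      rw [form, e, e, Matrix.toBilin'_single]
      rfl
    rw [this]
    split_ifs <;> first | omega | simp
  rw [h]
  rfl

/-- Interior points of the interval have both neighbours in it, so they cancel mod 2 and only terms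
at the boundary remain. For `a = b` the two middle terms cancel. -/
theorem form_eSum_Icc {a b : ℕ} (ha : 1 ≤ a) (hab : a ≤ b) (hb : b ≤ D) (v : V D) :
    form D (eSum D (Finset.Icc a b)) v =
      coord D (a - 1) v + coord D a v + coord D b v + coord D (b + 1) v := by
  induction b, hab using Nat.le_induction with
  | base =>
    have : eSum D (Finset.Icc a a) = e ⟨a, Finset.mem_Icc.2 ⟨ha, hb⟩⟩ := ext_coord fun x => by
      rw [coord_eSum, coord_e]
      simp only [Finset.mem_Icc]
      exact if_congr (by omega) rfl rfl
    rw [this, form_e]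
    linear_combination -CharTwo.add_self_eq_zero (coord D a v)
  | succ b hab ih =>
    have : eSum D (Finset.Icc a (b + 1)) =
        eSum D (Finset.Icc a b) + e ⟨b + 1, Finset.mem_Icc.2 ⟨by omega, hb⟩⟩ :=
      ext_coord fun x => by
        rw [map_add, coord_eSum, coord_eSum, coord_e]
        simp only [Finset.mem_Icc]
        split_ifs <;> first | omega | simp
    rw [this, map_add, LinearMap.add_apply, ih (by omega), form_e]
    dsimp only
    rw [Nat.add_sub_cancel]
    linear_combination CharTwo.add_self_eq_zero (coord D b v)

theorem form_eq_zero_of_mem_part {d : ℕ} {v w : V D} (hv : v ∈ part D (d : ZMod 2))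
    (hw : w ∈ part D (d : ZMod 2)) : form D v w = 0 := by
  rw [mem_part] at hw
  induction hv using Submodule.span_induction with
  | mem v hv =>
    obtain ⟨i, hi, rfl⟩ := hv
    have hi1 := Finset.mem_Icc.1 i.2
    have hi2 : (i : ℕ) % 2 = d % 2 := (ZMod.natCast_eq_natCast_iff _ _ _).1 hi
    rw [form_e, hw _ (by omega), hw _ (by omega), add_zero]
  | zero => simp
  | add v w _ _ hv hw => rw [map_add, LinearMap.add_apply, hv, hw, add_zero]
  | smul c v _ hv => rw [map_smul, LinearMap.smul_apply, hv, smul_zero]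

end Coordinates

/-! ### Description of the span of a family. -/

section Span

variable {D : ℕ} {B : Finset (ℕ × ℕ)}

open Classical in
/-- The sum of the `e_x` over the points `x` that `I` owns. -/
noncomputable def ownVec (D : ℕ) (B : Finset (ℕ × ℕ)) (I : ℕ × ℕ) : V D :=
  fun x => if Own B I x then 1 else 0

open Classical in
theorem coord_ownVec (hB : B ∈ S D) {I : ℕ × ℕ} (hI : I ∈ B) (x : ℕ) :
    coord D x (ownVec D B I) = if Own B I x then 1 else 0 := by
  have hi := mem_intervals.1 (hB.1 hI)
  by_cases hx : x ∈ Finset.Icc 1 D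
  · rw [coord_of_mem hx]
    rfl
  · rw [coord_of_not_mem hx, if_neg]
    intro h
    exact hx (Finset.mem_Icc.2 ⟨hi.1.trans h.1, h.2.1.trans hi.2.2.1⟩)

theorem eSum_pts_eq_sum_ownVec (hB : B ∈ S D) {J : ℕ × ℕ} (hJ : J ∈ B) :
    eSum D (pts J) = ∑ K ∈ B.filter (fun K => J.1 ≤ K.1 ∧ K.2 ≤ J.2), ownVec D B K := by
  classical
  refine ext_coord fun x => ?_
  rw [coord_eSum_pts hB hJ, map_sum]
  split_ifs with hx
  · obtain ⟨I, hI, hIx⟩ := exists_own ⟨J, hJ, hx⟩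
    have hIJ : J.1 ≤ I.1 ∧ I.2 ≤ J.2 := by
      rcases eq_or_prec_of_own hB hI hJ hIx hx.1 hx.2 with rfl | h
      · exact ⟨le_rfl, le_rfl⟩
      · exact ⟨h.1.le, h.2.2.le⟩
    rw [Finset.sum_eq_single_of_mem I (Finset.mem_filter.2 ⟨hI, hIJ⟩), coord_ownVec hB hI,
      if_pos hIx]
    intro K hK hKI
    have hKB := (Finset.mem_filter.1 hK).1
    rw [coord_ownVec hB hKB, if_neg fun h => hKI (own_unique hB hKB hI h hIx)]
  · refine (Finset.sum_eq_zero fun K hK => ?_).symm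
    rw [Finset.mem_filter] at hK
    rw [coord_ownVec hB hK.1, if_neg]
    intro h
    exact hx ⟨hK.2.1.trans h.1, h.2.1.trans hK.2.2⟩

/-- `eSum_pts_eq_sum_ownVec` is a unitriangular system with respect to inclusion; it is inverted by
induction on length. -/
theorem ownVec_mem_spanB (hB : B ∈ S D) {I : ℕ × ℕ} (hI : I ∈ B) :
    ownVec D B I ∈ spanB D B := by
  classical
  induction hn : I.2 - I.1 using Nat.strong_induction_on generalizing I with
  | _ n ih =>
    have hmem : I ∈ B.filter fun K => I.1 ≤ K.1 ∧ K.2 ≤ I.2 := by simp [hI]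
    have hsum := eSum_pts_eq_sum_ownVec hB hI
    rw [← Finset.add_sum_erase _ _ hmem] at hsum
    rw [← sub_eq_iff_eq_add] at hsum
    rw [← hsum]
    refine Submodule.sub_mem _ (Submodule.subset_span ⟨I, hI, rfl⟩)
      (Submodule.sum_mem _ fun K hK => ?_)
    rw [Finset.mem_erase, Finset.mem_filter] at hK
    have hi := mem_intervals.1 (hB.1 hI)
    have hk := mem_intervals.1 (hB.1 hK.2.1)
    refine ih _ ?_ hK.2.1 rfl
    have hne := hK.1
    rw [Ne, Prod.ext_iff] at hne
    omega

theorem mem_spanB (hB : B ∈ S D) {v : V D} :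
    v ∈ spanB D B ↔ (∀ x, ¬Cov B x → coord D x v = 0) ∧
      ∀ I ∈ B, ∀ x, Own B I x → coord D x v = coord D I.2 v := by
  classical
  constructor
  · intro h
    induction h using Submodule.span_induction with
    | mem v hv =>
      obtain ⟨J, hJ, rfl⟩ := hv
      simp only [coord_eSum_pts hB hJ]
      refine ⟨fun x hx => if_neg fun h => hx ⟨J, hJ, h⟩, fun I hI x hx => ?_⟩
      have hI2 := own_right hB hI
      refine if_congr ⟨fun h => ?_, fun h => ?_⟩ rfl rfl
      · rcases eq_or_prec_of_own hB hI hJ hx h.1 h.2 with rfl | h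
        · exact ⟨hI2.1, hI2.2.1⟩
        · exact ⟨h.1.le.trans h.2.1, h.2.2.le⟩
      · rcases eq_or_prec_of_own hB hI hJ hI2 h.1 h.2 with rfl | h
        · exact ⟨hx.1, hx.2.1⟩
        · exact ⟨h.1.le.trans hx.1, hx.2.1.trans h.2.2.le⟩
    | zero => simp
    | add v w _ _ hv hw =>
      refine ⟨fun x hx => ?_, fun I hI x hx => ?_⟩
      · rw [map_add, hv.1 x hx, hw.1 x hx, add_zero]
      · rw [map_add, map_add, hv.2 I hI x hx, hw.2 I hI x hx]
    | smul c v _ hv =>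
      refine ⟨fun x hx => ?_, fun I hI x hx => ?_⟩
      · rw [map_smul, hv.1 x hx, smul_zero]
      · rw [map_smul, map_smul, hv.2 I hI x hx]
  · rintro ⟨h0, h1⟩
    have hv : v = ∑ I ∈ B, coord D I.2 v • ownVec D B I := by
      refine ext_coord fun x => ?_
      rw [map_sum]
      by_cases hx : Cov B x
      · obtain ⟨I, hI, hIx⟩ := exists_own hx
        rw [Finset.sum_eq_single_of_mem I hI, map_smul, coord_ownVec hB hI, if_pos hIx,
          smul_eq_mul, mul_one, h1 I hI x hIx]
        intro K hK hKI
        rw [map_smul, coord_ownVec hB hK, if_neg fun h => hKI (own_unique hB hK hI h hIx),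
          smul_zero]
      · rw [h0 x hx]
        refine (Finset.sum_eq_zero fun K hK => ?_).symm
        rw [map_smul, coord_ownVec hB hK, if_neg fun h => hx ⟨K, hK, h.1, h.2.1⟩, smul_zero]
    rw [hv]
    exact Submodule.sum_mem _ fun I hI => Submodule.smul_mem _ _ (ownVec_mem_spanB hB hI)

theorem ownVec_mem_part (hB : B ∈ S D) {I : ℕ × ℕ} (hI : I ∈ B) {d : ℕ}
    (hd : I.1 % 2 = d % 2) : ownVec D B I ∈ part D (d : ZMod 2) := by
  classical
  rw [mem_part]
  intro x hx
  rw [coord_ownVec hB hI, if_neg]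
  intro h
  have := h.mod_two_eq hB hI
  omega

theorem ownVec_mem_spanPart (hB : B ∈ S D) {I : ℕ × ℕ} (hI : I ∈ B) {d : ℕ}
    (hd : I.1 % 2 = d % 2) : ownVec D B I ∈ spanPart D (d : ZMod 2) B :=
  ⟨ownVec_mem_spanB hB hI, ownVec_mem_part hB hI hd⟩

theorem spanPart_le_spanB (δ : ZMod 2) : spanPart D δ B ≤ spanB D B := inf_le_left

theorem spanB_eq_sup (hB : B ∈ S D) : spanB D B = spanPart D 1 B ⊔ spanPart D 0 B := by
  classical
  refine le_antisymm (Submodule.span_le.2 ?_)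
    (sup_le (spanPart_le_spanB 1) (spanPart_le_spanB 0))
  rintro _ ⟨I, hI, rfl⟩
  rw [eSum_pts_eq_sum_ownVec hB hI]
  refine Submodule.sum_mem _ fun K hK => ?_
  have hKB := (Finset.mem_filter.1 hK).1
  rcases Nat.mod_two_eq_zero_or_one K.1 with h | h
  · exact Submodule.mem_sup_right (by simpa using ownVec_mem_spanPart hB hKB (d := 0) h)
  · exact Submodule.mem_sup_left (by simpa using ownVec_mem_spanPart hB hKB (d := 1) h)

/-- The owned sets of parity `d` are the classes on which all vectors of the subspace are constant.
The class of `I.1` is thus the same for both families, and its least and greatest points are the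
ends of its owner. -/
theorem mem_of_spanPart_eq {B' : Finset (ℕ × ℕ)} (hB : B ∈ S D) (hB' : B' ∈ S D) {d : ℕ}
    (h : spanPart D (d : ZMod 2) B = spanPart D (d : ZMod 2) B') {I : ℕ × ℕ} (hI : I ∈ B)
    (hd : I.1 % 2 = d % 2) : I ∈ B' := by
  classical
  have hu : ownVec D B I ∈ spanPart D (d : ZMod 2) B' := h ▸ ownVec_mem_spanPart hB hI hd
  have hu' := (mem_spanB hB').1 hu.1
  simp only [coord_ownVec hB hI] at hu'
  have hl := own_left hB hI
  have hr := own_right hB hI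
  have hc : Cov B' I.1 := by
    by_contra hc
    have := hu'.1 _ hc
    rw [if_pos hl] at this
    exact one_ne_zero this
  obtain ⟨J, hJ, hJI⟩ := exists_own hc
  have hJd : J.1 % 2 = d % 2 := by rw [← hJI.mod_two_eq hB' hJ, hd]
  have hw : ownVec D B' J ∈ spanPart D (d : ZMod 2) B := h ▸ ownVec_mem_spanPart hB' hJ hJd
  have hw' := (mem_spanB hB).1 hw.1
  simp only [coord_ownVec hB' hJ] at hw'
  have h2 : Own B I J.2 := by
    have := hu'.2 J hJ _ hJI
    rw [if_pos hl] at this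
    by_contra hn
    rw [if_neg hn] at this
    exact one_ne_zero this
  have h1 : Own B I J.1 := by
    have := hu'.2 J hJ _ (own_left hB' hJ)
    rw [if_pos h2] at this
    by_contra hn
    rw [if_neg hn] at this
    exact one_ne_zero this.symm
  have h3 : Own B' J I.2 := by
    have := hw'.2 I hI _ hl
    rw [if_pos hJI] at this
    by_contra hn
    rw [if_neg hn] at this
    exact one_ne_zero this
  have : I = J := Prod.ext (le_antisymm h1.1 hJI.1) (le_antisymm h3.2.1 h2.2.1)
  rwa [this]

/-- Since no added interval lies inside a member of `B`, owned sets of members of `B` do not change;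
points newly covered have the wrong parity to matter. -/
theorem spanPart_eq_of_subset {B' : Finset (ℕ × ℕ)} (hB : B ∈ S D) (hB' : B' ∈ S D)
    (hsub : B ⊆ B') {d : ℕ} (hpar : ∀ I ∈ B', I ∉ B → I.1 % 2 ≠ d % 2)
    (hdown : ∀ J ∈ B', ∀ I ∈ B, Prec J I → J ∈ B) :
    spanPart D (d : ZMod 2) B = spanPart D (d : ZMod 2) B' := by
  have hown : ∀ I ∈ B, ∀ x, Own B I x → Own B' I x := fun I hI x hx =>
    ⟨hx.1, hx.2.1, fun J hJ hJI => hx.2.2 J (hdown J hJ I hI hJI) hJI⟩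
  refine le_antisymm (inf_le_inf_right _ (Submodule.span_mono ?_)) fun v hv => ⟨?_, hv.2⟩
  · rintro _ ⟨I, hI, rfl⟩
    exact ⟨I, hsub hI, rfl⟩
  · have h1 := (mem_spanB hB').1 hv.1
    refine (mem_spanB hB).2 ⟨fun x hx => ?_, fun I hI x hx => h1.2 I (hsub hI) x (hown I hI x hx)⟩
    by_cases hc : Cov B' x
    · obtain ⟨I, hI, hIx⟩ := exists_own hc
      have hm := hIx.mod_two_eq hB' hI
      have := hpar I hI fun h => hx ⟨I, h, hIx.1, hIx.2.1⟩
      exact mem_part.1 hv.2 x (by omega)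
    · exact h1.1 x hc

theorem spanPart_trim (hB : B ∈ S D) {d : ℕ} (hd : d < 2) :
    spanPart D (d : ZMod 2) (trim d B) = spanPart D (d : ZMod 2) B := by
  refine spanPart_eq_of_subset (trim_mem_S hB d) hB (trim_subset d B) (fun I hI h hId => ?_)
    fun J hJ I hI h => mem_trim.2 ⟨hJ, Or.inr ⟨I, trim_subset d B hI, h⟩⟩
  exact h (mem_trim.2 ⟨hI, Or.inl (by omega)⟩)

theorem spanPart_fill (hB : B ∈ S D) {d : ℕ}
    (hpar : ∀ I ∈ B, I.1 % 2 = d ∨ ∃ P ∈ B, Prec I P ∧ P.1 % 2 = d) :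
    spanPart D (d : ZMod 2) (fill D d B) = spanPart D (d : ZMod 2) B := by
  refine (spanPart_eq_of_subset hB (fill_mem_S hB hpar) (fun I hI => mem_fill.2 (Or.inl hI))
    (fun I hI h => ?_) fun J hJ I hI h => ?_).symm
  · obtain ⟨hi, hd, -⟩ := mem_gaps.1 ((mem_fill.1 hI).resolve_left h)
    rw [mem_intervals] at hi
    omega
  · refine (mem_fill.1 hJ).resolve_right fun hJg => ?_
    rcases apart_or_prec_of_mem_gaps hB hpar hI hJg with h' | h'
    · simp only [Apart, Prec] at h h'
      omega
    · simp only [Prec] at h h'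
      omega

end Span

/-! ### Isotropy, and mutual annihilators for full families. -/

section Orthogonality

variable {D : ℕ} {B : Finset (ℕ × ℕ)}

theorem form_eSum_pts (hB : B ∈ S D) {I : ℕ × ℕ} (hI : I ∈ B) (v : V D) :
    form D (eSum D (pts I)) v =
      coord D (I.1 - 1) v + coord D I.1 v + coord D I.2 v + coord D (I.2 + 1) v := by
  have hi := mem_intervals.1 (hB.1 hI)
  exact form_eSum_Icc hi.1 hi.2.1 hi.2.2.1 v

theorem form_eq_zero_of_mem_spanB (hB : B ∈ S D) {v w : V D} (hv : v ∈ spanB D B)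
    (hw : w ∈ spanB D B) : form D v w = 0 := by
  have key : ∀ I ∈ B, ∀ J ∈ B, form D (eSum D (pts I)) (eSum D (pts J)) = 0 := by
    intro I hI J hJ
    have hi := mem_intervals.1 (hB.1 hI)
    have hj := mem_intervals.1 (hB.1 hJ)
    rw [form_eSum_pts hB hI]
    simp only [coord_eSum_pts hB hJ]
    have h := hB.2.1 I hI J hJ
    rw [Prod.ext_iff] at h
    simp only [Apart, Prec] at h
    split_ifs <;> first | omega | decide
  induction hv using Submodule.span_induction with
  | mem v hv =>
    obtain ⟨I, hI, rfl⟩ := hv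
    induction hw using Submodule.span_induction with
    | mem w hw =>
      obtain ⟨J, hJ, rfl⟩ := hw
      exact key I hI J hJ
    | zero => simp
    | add v w _ _ hv hw => rw [map_add, hv, hw, add_zero]
    | smul c v _ hv => rw [map_smul, hv, smul_zero]
  | zero => simp
  | add v w _ _ hv hw => rw [map_add, LinearMap.add_apply, hv, hw, add_zero]
  | smul c v _ hv => rw [map_smul, LinearMap.smul_apply, hv, smul_zero]

theorem coord_right_neighbour {d : ℕ} {y : V D} (hB : B ∈ S D)
    (hy : y ∈ part D (d : ZMod 2)) {I : ℕ × ℕ} (hI : I ∈ B) (hd : I.1 % 2 ≠ d % 2)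
    (horth : form D (eSum D (pts I)) y = 0) : coord D (I.1 - 1) y = coord D (I.2 + 1) y := by
  have hi := mem_intervals.1 (hB.1 hI)
  rw [form_eSum_pts hB hI, mem_part.1 hy I.1 hd, mem_part.1 hy I.2 (by omega), add_zero,
    add_zero] at horth
  exact CharTwo.add_eq_zero.1 horth

/-- Consecutive points owned by `I` are separated by a child `K` of the opposite parity, and
orthogonality to `e_K` equates the coordinates on its two sides. -/
theorem mem_spanB_of_orthogonal (hB : B ∈ S D) {d : ℕ} {y : V D}
    (hy : y ∈ part D (d : ZMod 2)) (horth : ∀ I ∈ B, form D (eSum D (pts I)) y = 0)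
    (h0 : ∀ x, ¬Cov B x → coord D x y = 0) : y ∈ spanB D B := by
  refine (mem_spanB hB).2 ⟨h0, fun I hI p hp => ?_⟩
  have hi := mem_intervals.1 (hB.1 hI)
  induction hn : I.2 - p using Nat.strong_induction_on generalizing p with
  | _ n ih =>
    rcases hp.2.1.eq_or_lt with h | h
    · rw [h]
    · have hm := hp.mod_two_eq hB hI
      by_cases hd : I.1 % 2 = d % 2
      · obtain ⟨K, hK, hKI, hKp, hKo⟩ := hp.exists_child hB hI h
        have hk := mem_intervals.1 (hB.1 hK)
        have hc := coord_right_neighbour hB hy hK (by omega) (horth K hK)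
        rw [hKp, Nat.add_sub_cancel] at hc
        rw [hc]
        exact ih _ (by omega) _ hKo rfl
      · rw [mem_part.1 hy p (by omega), mem_part.1 hy I.2 (by omega)]

/-- At an uncovered odd `p < D`, fullness gives an interval starting at `p + 1`. Orthogonality moves
the coordinate to the point after it, again uncovered, until `D + 1` is reached, where it is zero.
The even case runs leftwards to `0`. -/
theorem coord_eq_zero_of_full_one (hD : Even D) (hB : B ∈ S D) (hf : Full D B) {y : V D}
    (hy : y ∈ part D 1) (horth : ∀ I ∈ B, form D (eSum D (pts I)) y = 0) :
    ∀ x, ¬Cov B x → coord D x y = 0 := by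
  have hD2 : D % 2 = 0 := Nat.even_iff.1 hD
  have hy' : y ∈ part D ((1 : ℕ) : ZMod 2) := by simpa using hy
  intro p hp
  induction hn : D - p using Nat.strong_induction_on generalizing p with
  | _ n ih =>
    by_cases hpar : p % 2 = 1
    · by_cases hpD : p < D
      · obtain ⟨I, hI, h⟩ := hf p hpar hpD
        have hi := mem_intervals.1 (hB.1 hI)
        have hI1 : I.1 = p + 1 := h.resolve_left fun h => hp ⟨I, hI, by omega, by omega⟩
        have hc := coord_right_neighbour hB hy' hI (by omega) (horth I hI)
        rw [hI1, Nat.add_sub_cancel] at hc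
        rw [hc]
        refine ih _ (by omega) _ ?_ rfl
        rintro ⟨J, hJ, h1, h2⟩
        have := prec_of_right_neighbour hB hI hJ h1 h2
        simp only [Prec] at this
        exact hp ⟨J, hJ, by omega, by omega⟩
      · refine coord_of_not_mem (fun h' => ?_) y
        rw [Finset.mem_Icc] at h'
        omega
    · exact mem_part.1 hy' p (by omega)

theorem coord_eq_zero_of_full_zero (hD : Even D) (hB : B ∈ S D) (hf : Full D B) {y : V D}
    (hy : y ∈ part D 0) (horth : ∀ I ∈ B, form D (eSum D (pts I)) y = 0) :
    ∀ x, ¬Cov B x → coord D x y = 0 := by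
  have hD2 : D % 2 = 0 := Nat.even_iff.1 hD
  have hy' : y ∈ part D ((0 : ℕ) : ZMod 2) := by simpa using hy
  intro p hp
  induction p using Nat.strong_induction_on with
  | _ p ih =>
    by_cases hpD : p ∈ Finset.Icc 1 D
    · by_cases hpar : p % 2 = 0
      · rw [Finset.mem_Icc] at hpD
        obtain ⟨I, hI, h⟩ := hf (p - 1) (by omega) (by omega)
        have hi := mem_intervals.1 (hB.1 hI)
        have hI2 : I.2 = p - 1 := h.resolve_right fun h => hp ⟨I, hI, by omega, by omega⟩
        have hc := coord_right_neighbour hB hy' hI (by omega) (horth I hI)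
        rw [hI2, Nat.sub_add_cancel (by omega)] at hc
        rw [← hc]
        refine ih _ (by omega) ?_
        rintro ⟨J, hJ, h1, h2⟩
        have := prec_of_left_neighbour hB hI hJ h1 h2
        simp only [Prec] at this
        exact hp ⟨J, hJ, by omega, by omega⟩
      · exact mem_part.1 hy' p (by omega)
    · exact coord_of_not_mem hpD y

theorem mem_bang_zero {L : Submodule (ZMod 2) (V D)} {y : V D} :
    y ∈ bang D 0 L ↔ y ∈ part D 1 ∧ ∀ v ∈ L, form D v y = 0 := by
  rw [bang, sub_zero]
  exact Iff.rfl

theorem mem_bang_one {L : Submodule (ZMod 2) (V D)} {y : V D} :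
    y ∈ bang D 1 L ↔ y ∈ part D 0 ∧ ∀ v ∈ L, form D v y = 0 := by
  rw [bang, sub_self]
  exact Iff.rfl

theorem bang_zero_anti {L L' : Submodule (ZMod 2) (V D)} (h : L ≤ L') :
    bang D 0 L' ≤ bang D 0 L := fun y hy => by
  rw [mem_bang_zero] at hy ⊢
  exact ⟨hy.1, fun v hv => hy.2 v (h hv)⟩

theorem spanPart_one_le_bang (hB : B ∈ S D) : spanPart D 1 B ≤ bang D 0 (spanPart D 0 B) :=
  fun _ hy => mem_bang_zero.2 ⟨hy.2, fun _ hv => form_eq_zero_of_mem_spanB hB hv.1 hy.1⟩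

theorem spanPart_zero_le_bang (hB : B ∈ S D) : spanPart D 0 B ≤ bang D 1 (spanPart D 1 B) :=
  fun _ hy => mem_bang_one.2 ⟨hy.2, fun _ hv => form_eq_zero_of_mem_spanB hB hv.1 hy.1⟩

/-- Although `e_I` need not be homogeneous, its component in `V_D^1` pairs to zero with `y` for
parity reasons. -/
theorem form_eSum_eq_zero_of_mem_bang_zero (hB : B ∈ S D) {y : V D}
    (hy : y ∈ bang D 0 (spanPart D 0 B)) {I : ℕ × ℕ} (hI : I ∈ B) :
    form D (eSum D (pts I)) y = 0 := by
  rw [mem_bang_zero] at hy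
  have hmem : eSum D (pts I) ∈ spanB D B := Submodule.subset_span ⟨I, hI, rfl⟩
  rw [spanB_eq_sup hB] at hmem
  obtain ⟨v, hv, w, hw, hvw⟩ := Submodule.mem_sup.1 hmem
  rw [← hvw, map_add, LinearMap.add_apply, hy.2 w hw, add_zero]
  exact form_eq_zero_of_mem_part (d := 1) (by simpa using hv.2) (by simpa using hy.1)

theorem form_eSum_eq_zero_of_mem_bang_one (hB : B ∈ S D) {y : V D}
    (hy : y ∈ bang D 1 (spanPart D 1 B)) {I : ℕ × ℕ} (hI : I ∈ B) :
    form D (eSum D (pts I)) y = 0 := by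
  rw [mem_bang_one] at hy
  have hmem : eSum D (pts I) ∈ spanB D B := Submodule.subset_span ⟨I, hI, rfl⟩
  rw [spanB_eq_sup hB] at hmem
  obtain ⟨v, hv, w, hw, hvw⟩ := Submodule.mem_sup.1 hmem
  rw [← hvw, map_add, LinearMap.add_apply, hy.2 v hv, zero_add]
  exact form_eq_zero_of_mem_part (d := 0) (by simpa using hw.2) (by simpa using hy.1)

theorem Full.bang_zero (hD : Even D) (hB : B ∈ S D) (hf : Full D B) :
    bang D 0 (spanPart D 0 B) = spanPart D 1 B := by
  refine le_antisymm (fun y hy => ?_) (spanPart_one_le_bang hB)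
  have horth := fun I hI => form_eSum_eq_zero_of_mem_bang_zero hB hy (I := I) hI
  have hy1 := (mem_bang_zero.1 hy).1
  exact ⟨mem_spanB_of_orthogonal hB (d := 1) (by simpa using hy1) horth
    (coord_eq_zero_of_full_one hD hB hf hy1 horth), hy1⟩

theorem Full.bang_one (hD : Even D) (hB : B ∈ S D) (hf : Full D B) :
    bang D 1 (spanPart D 1 B) = spanPart D 0 B := by
  refine le_antisymm (fun y hy => ?_) (spanPart_zero_le_bang hB)
  have horth := fun I hI => form_eSum_eq_zero_of_mem_bang_one hB hy (I := I) hI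
  have hy1 := (mem_bang_one.1 hy).1
  exact ⟨mem_spanB_of_orthogonal hB (d := 0) (by simpa using hy1) horth
    (coord_eq_zero_of_full_zero hD hB hf hy1 horth), hy1⟩

end Orthogonality

/-! ### Recovering the family, double annihilators and maximal partners. -/

section Uniqueness

variable {D : ℕ} {B B' : Finset (ℕ × ℕ)}

theorem subset_of_spanPart_eq (hB : B ∈ S D) (hB' : B' ∈ S D)
    (h1 : spanPart D 1 B = spanPart D 1 B') (h0 : spanPart D 0 B = spanPart D 0 B') :
    B ⊆ B' := by
  intro I hI
  rcases Nat.mod_two_eq_zero_or_one I.1 with h | h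
  · exact mem_of_spanPart_eq hB hB' (d := 0) (by simpa using h0) hI h
  · exact mem_of_spanPart_eq hB hB' (d := 1) (by simpa using h1) hI h

theorem eq_of_spanPart_eq (hB : B ∈ S D) (hB' : B' ∈ S D)
    (h1 : spanPart D 1 B = spanPart D 1 B') (h0 : spanPart D 0 B = spanPart D 0 B') :
    B = B' :=
  (subset_of_spanPart_eq hB hB' h1 h0).antisymm (subset_of_spanPart_eq hB' hB h1.symm h0.symm)

theorem exists_odd_of_cov_of_mem_SOne (hB : B ∈ SOne D) {x : ℕ} (hx : Cov B x) :
    ∃ I ∈ B, I.1 % 2 = 1 ∧ I.1 ≤ x ∧ x ≤ I.2 := by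
  obtain ⟨I, hI, h1, h2⟩ := hx
  by_cases h : I.1 % 2 = 1
  · exact ⟨I, hI, h, h1, h2⟩
  · have hm : mult I B ≠ 1 := fun hm => h (hB.2 I hI hm)
    rw [Ne, mult_eq_one_iff hB.1 hI] at hm
    push Not at hm
    obtain ⟨J, hJ, hIJ⟩ := hm
    obtain ⟨P, hP, hIP, hpar⟩ := exists_prec_mod_two_ne hB.1 hI hJ hIJ
    simp only [Prec] at hIP
    exact ⟨P, hP, by omega, by omega, by omega⟩

/-- The two families share their odd intervals, and these cover the union of `B`; so a vector of
`⟨B⟩_0` has the support and orthogonality required by `mem_spanB_of_orthogonal`. -/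
theorem spanPart_zero_le_of_mem_SOne (hB : B ∈ SOne D) (hB' : B' ∈ SOne D)
    (h : spanPart D 1 B = spanPart D 1 B') : spanPart D 0 B ≤ spanPart D 0 B' := by
  intro y hy
  have hyb : y ∈ bang D 1 (spanPart D 1 B') := h ▸ spanPart_zero_le_bang hB.1 hy
  refine ⟨mem_spanB_of_orthogonal hB'.1 (d := 0) (by simpa using hy.2)
    (fun I hI => form_eSum_eq_zero_of_mem_bang_one hB'.1 hyb hI) fun x hx => ?_, hy.2⟩
  refine ((mem_spanB hB.1).1 hy.1).1 x fun hc => hx ?_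
  obtain ⟨I, hI, hpar, hIx⟩ := exists_odd_of_cov_of_mem_SOne hB hc
  exact ⟨I, mem_of_spanPart_eq hB.1 hB'.1 (d := 1) (by simpa using h) hI hpar, hIx⟩

theorem eq_of_mem_SOne (hB : B ∈ SOne D) (hB' : B' ∈ SOne D)
    (h : spanPart D 1 B = spanPart D 1 B') : B = B' :=
  eq_of_spanPart_eq hB.1 hB'.1 h
    ((spanPart_zero_le_of_mem_SOne hB hB' h).antisymm
      (spanPart_zero_le_of_mem_SOne hB' hB h.symm))

theorem spanPart_one_trim (hB : B ∈ S D) : spanPart D 1 (trim 1 B) = spanPart D 1 B := by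
  simpa using spanPart_trim hB one_lt_two

theorem exists_full_one (hD : Even D) (hB : B ∈ S D) :
    ∃ B' ∈ S D, Full D B' ∧ spanPart D 1 B' = spanPart D 1 B := by
  have hpar := fun I hI => exists_parent_mem_trim hB one_lt_two (I := I) hI
  refine ⟨_, fill_mem_S (trim_mem_S hB 1) hpar, full_fill_one hD (trim_mem_S hB 1), ?_⟩
  simpa using (spanPart_fill (trim_mem_S hB 1) hpar).trans (spanPart_trim hB one_lt_two)

theorem exists_full_zero (hB : B ∈ S D) :
    ∃ B' ∈ S D, Full D B' ∧ spanPart D 0 B' = spanPart D 0 B := by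
  have hpar := fun I hI => exists_parent_mem_trim hB zero_lt_two (I := I) hI
  refine ⟨_, fill_mem_S (trim_mem_S hB 0) hpar, full_fill_zero (trim_mem_S hB 0), ?_⟩
  simpa using (spanPart_fill (trim_mem_S hB 0) hpar).trans (spanPart_trim hB zero_lt_two)

/-- Replace `B` by a full family with the same even part; its odd part is the annihilator. -/
theorem bang_spanPart_zero_mem_C (hD : Even D) (hB : B ∈ S D) :
    bang D 0 (spanPart D 0 B) ∈ C D 1 := by
  obtain ⟨B', hB', hf, h⟩ := exists_full_zero hB
  exact ⟨B', hB', by rw [← h, hf.bang_zero hD hB']⟩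

theorem bang_bang_spanPart_zero (hD : Even D) (hB : B ∈ S D) :
    bang D 1 (bang D 0 (spanPart D 0 B)) = spanPart D 0 B := by
  obtain ⟨B', hB', hf, h⟩ := exists_full_zero hB
  rw [← h, hf.bang_zero hD hB', hf.bang_one hD hB']

theorem bang_bang_of_mem_C (hD : Even D) {L : Submodule (ZMod 2) (V D)} (hL : L ∈ C D 1) :
    bang D 0 (bang D 1 L) = L := by
  obtain ⟨B, hB, rfl⟩ := hL
  obtain ⟨B', hB', hf, h⟩ := exists_full_one hD hB
  rw [← h, hf.bang_one hD hB', hf.bang_zero hD hB']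

theorem disjoint_part (D : ℕ) : Disjoint (part D 1) (part D 0) := by
  rw [Submodule.disjoint_def]
  intro v h1 h0
  refine ext_coord fun x => ?_
  rw [map_zero]
  rcases Nat.mod_two_eq_zero_or_one x with h | h
  · exact (mem_part (d := 1)).1 (by simpa using h1) x (by omega)
  · exact (mem_part (d := 0)).1 (by simpa using h0) x (by omega)

theorem mem_A (hD : Even D) (hB : B ∈ S D) :
    (spanPart D 1 B, bang D 0 (spanPart D 0 B)) ∈ A D := by
  refine ⟨⟨B, hB, rfl⟩, bang_spanPart_zero_mem_C hD hB, spanPart_one_le_bang hB, B, hB, ?_, ?_⟩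
  · dsimp only
    rw [bang_bang_spanPart_zero hD hB]
    exact (disjoint_part D).mono inf_le_right inf_le_right
  · dsimp only
    rw [bang_bang_spanPart_zero hD hB, spanB_eq_sup hB]

theorem spanPart_of_sup_eq {L M : Submodule (ZMod 2) (V D)} (hL : L ≤ part D 1)
    (hM : M ≤ part D 0) (h : L ⊔ M = spanB D B) :
    spanPart D 1 B = L ∧ spanPart D 0 B = M := by
  constructor
  -- By the modular law, intersecting with one graded piece leaves that summand and kills the other.
  · rw [spanPart, ← h, sup_inf_assoc_of_le M hL, inf_comm M,
      (disjoint_part D).mono_right hM |>.eq_bot, sup_bot_eq]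
  · rw [spanPart, ← h, sup_comm, sup_inf_assoc_of_le L hM,
      (disjoint_part D).mono_left hL |>.eq_bot, sup_bot_eq]

theorem le_of_mem_A (hD : Even D) (hB : B ∈ SOne D) {L' : Submodule (ZMod 2) (V D)}
    (h : (spanPart D 1 B, L') ∈ A D) : L' ≤ bang D 0 (spanPart D 0 B) := by
  obtain ⟨-, hC, -, B₁, hB₁, -, hsup⟩ := h
  dsimp only at hC hsup
  obtain ⟨h1, h0⟩ := spanPart_of_sup_eq inf_le_right (fun y hy => (mem_bang_one.1 hy).1) hsup
  have heq : trim 1 B₁ = B :=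
    eq_of_mem_SOne (trim_mem_SOne hB₁) hB ((spanPart_one_trim hB₁).trans h1)
  -- Double annihilation turns the claim into `⟨B⟩_0 ⊆ ⟨B₁⟩_0`, which holds because `B` is a
  -- subfamily of `B₁`.
  rw [← bang_bang_of_mem_C hD hC, ← h0, ← heq]
  refine bang_zero_anti (inf_le_inf_right _ (Submodule.span_mono ?_))
  rintro _ ⟨I, hI, rfl⟩
  exact ⟨I, trim_subset 1 B₁ hI, rfl⟩

theorem isMaxPartner_iff (hD : Even D) (hB : B ∈ SOne D) {L' : Submodule (ZMod 2) (V D)} :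
    IsMaxPartner D (spanPart D 1 B) L' ↔ L' = bang D 0 (spanPart D 0 B) := by
  constructor
  · rintro ⟨hA, hmax⟩
    exact SetLike.coe_injective
      (Set.eq_of_subset_of_ncard_le (le_of_mem_A hD hB hA) (hmax _ (mem_A hD hB.1)))
  · rintro rfl
    exact ⟨mem_A hD hB.1, fun L'' h =>
      Nat.card_mono (Set.toFinite _) (le_of_mem_A hD hB h)⟩

theorem bijOn_SHalf (hD : Even D) :
    Set.BijOn (fun B => spanPart D 1 B) (SHalf D) (C D 1) := by
  refine ⟨fun B hB => ⟨B, hB.1, rfl⟩, fun B hB B' hB' h => ?_, ?_⟩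
  · dsimp only at h
    refine eq_of_spanPart_eq hB.1 hB'.1 h ?_
    rw [← Full.bang_one hD hB.1 ((card_eq_iff_full hD hB.1).1 hB.2), h,
      Full.bang_one hD hB'.1 ((card_eq_iff_full hD hB'.1).1 hB'.2)]
  · rintro _ ⟨B, hB, rfl⟩
    obtain ⟨B', hB', hf, h⟩ := exists_full_one hD hB
    exact ⟨B', ⟨hB', (card_eq_iff_full hD hB').2 hf⟩, h⟩

theorem bijOn_SOne (D : ℕ) : Set.BijOn (fun B => spanPart D 1 B) (SOne D) (C D 1) := by
  refine ⟨fun B hB => ⟨B, hB.1, rfl⟩, fun B hB B' hB' h => eq_of_mem_SOne hB hB' h, ?_⟩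
  rintro _ ⟨B, hB, rfl⟩
  exact ⟨trim 1 B, trim_mem_SOne hB, spanPart_one_trim hB⟩

end Uniqueness

end AlmostSpecial

theorem mainTheorem5 (D : ℕ) (hD : Even D) :
    Set.BijOn (fun B => AlmostSpecial.spanPart D 1 B)
      (AlmostSpecial.SHalf D) (AlmostSpecial.C D 1) ∧
    Set.BijOn (fun B => AlmostSpecial.spanPart D 1 B)
      (AlmostSpecial.SOne D) (AlmostSpecial.C D 1) ∧
    (∀ L ∈ AlmostSpecial.C D 1, ∃! L', AlmostSpecial.IsMaxPartner D L L') ∧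
    Set.BijOn
      (fun B => (AlmostSpecial.spanPart D 1 B,
        AlmostSpecial.bang D 0 (AlmostSpecial.spanPart D 0 B)))
      (AlmostSpecial.SOne D) (AlmostSpecial.AStar D) := by
  have hone := AlmostSpecial.bijOn_SOne D
  refine ⟨AlmostSpecial.bijOn_SHalf hD, hone, fun L hL => ?_, fun B hB => ?_,
    fun B hB B' hB' h => hone.injOn hB hB' (congrArg Prod.fst h), ?_⟩
  · obtain ⟨B, hB, rfl⟩ := hone.surjOn hL
    exact ⟨_, (AlmostSpecial.isMaxPartner_iff hD hB).2 rfl, fun L' hL' =>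
      (AlmostSpecial.isMaxPartner_iff hD hB).1 hL'⟩
  · exact ⟨hone.mapsTo hB, AlmostSpecial.bang_spanPart_zero_mem_C hD hB.1,
      (AlmostSpecial.isMaxPartner_iff hD hB).2 rfl⟩
  · rintro ⟨L, L'⟩ ⟨hL, -, hmax⟩
    obtain ⟨B, hB, rfl⟩ := hone.surjOn hL
    exact ⟨B, hB, Prod.ext rfl ((AlmostSpecial.isMaxPartner_iff hD hB).1 hmax).symm⟩
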